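/- **Converse coding theorem.** Fix $\kappa\in[0,\infty)$, $v_0\in\mathbb R$, real numbers $c_t$ and variances $K_{W_t}>0$, $t=1,2,\dots$. Consider the additive Gaussian noise channel $Y_t=X_t+V_t$ driven by the AR$(c_t)$ noise $V_t=c_tV_{t-1}+W_t$, $t\ge 1$, with initial state $V_0=v_0$ known to the encoder and the decoder, where the $W_t\sim N(0,K_{W_t})$ are independent (and independent of $V_0$). A feedback code of block length $n$ consists of a message $W$ uniformly distributed on $\{1,\dots,M_n\}$, $M_n\in\mathbb N$, and independent of the noise; measurable encoders $X_t=e_t(W,v_0,X^{t-1},Y^{t-1})$, $t=1,\dots,n$, with $\frac1n\mathbf E_{v_0}\big\{\sum_{t=1}^n X_t^2\big\}\le\kappa$; and a measurable decoder $d_n(v_0,Y^n)\in\{1,\dots,M_n\}$ with average error probability $\mathbf P_{v_0}\{d_n(v_0,Y^n)\ne W\}\le\epsilon_n$. A number $R(v_0)\in\mathbb R$ is an achievable rate if there is a sequence of feedback codes, $n=1,2,\dots$, with $\epsilon_n\to0$ and $\liminf_{n\to\infty}\frac1n\log M_n\ge R(v_0)$. For real $\Lambda_t$ and $K_{Z_t}\ge0$,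 $t=1,\dots,n$, let $K_0=0$ and let $K_t\ge 0$ be given by the difference Riccati equation $$K_t=c_t^2K_{t-1}+K_{W_t}-\frac{\big(K_{W_t}+c_tK_{t-1}(\Lambda_t+c_t)\big)^2}{K_{Z_t}+K_{W_t}+(\Lambda_t+c_t)^2K_{t-1}},\qquad t=1,\dots,n,$$ and define $$C_n(\kappa,v_0)=\sup\ \frac12\sum_{t=1}^n\log\frac{(\Lambda_t+c_t)^2K_{t-1}+K_{Z_t}+K_{W_t}}{K_{W_t}},$$ where the supremum is over all $(\Lambda_t,K_{Z_t})_{t=1}^n$ with $K_{Z_t}\ge 0$ and $\frac1n\sum_{t=1}^n\big(\Lambda_t^2K_{t-1}+K_{Z_t}\big)\le\kappa$. Suppose that (C1) for every $n\ge1$ a maximizing element $(\Lambda_t^*,K_{Z_t}^*)_{t=1}^n$ satisfying the power constraint exists, and (C2) the limit $C(\kappa,v_0)=\lim_{n\to\infty}\frac1nC_n(\kappa,v_0)$ exists and is finite. Then every achievable rate satisfies $$R(v_0)\le C(\kappa,v_0)=\lim_{n\to\infty}\frac1n\,C_n(\kappa,v_0).$$ -/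

import Mathlib

open scoped NNReal

noncomputable section

namespace AGN

/-! ### The autoregressive noise -/

/-- The `AR(c_t)` noise started at `V_0 = v₀` and driven by the innovations `w_1, w_2, …`:
`V_t = c_t V_{t-1} + w_t`.  The entries `c 0` and `w 0` are not used. -/
def arNoise (c : ℕ → ℝ) (v₀ : ℝ) (w : ℕ → ℝ) : ℕ → ℝ
  | 0 => v₀
  | t + 1 => c (t + 1) * arNoise c v₀ w t + w (t + 1)

/-- The law of the innovations: independent, `W_t ∼ N(0, K_{W_t})`.  They are independent of `V_0`,
so this is also their law given `V_0 = v₀`. -/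
def innovLaw (KW : ℕ → ℝ≥0) : MeasureTheory.Measure (ℕ → ℝ) :=
  MeasureTheory.Measure.infinitePi fun t => ProbabilityTheory.gaussianReal 0 (KW t)

/-! ### Feedback codes -/

/-- A feedback code of block length `n` with message set `Fin M` (that `M` is positive follows from
the existence of the decoder).  `enc t` is the encoder at time `t + 1`: it maps the message, the
initial state, the past inputs `X_1, …, X_t` and the past outputs `Y_1, …, Y_t` to the input
`X_{t+1}`; only the times `t + 1 ≤ n` matter. -/
structure FeedbackCode (n : ℕ) where
  M : ℕ
  enc : (t : ℕ) → Fin M → ℝ → (Fin t → ℝ) → (Fin t → ℝ) → ℝ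
  dec : ℝ → (Fin n → ℝ) → Fin M
  measurable_enc : ∀ t < n, ∀ (m : Fin M) (v₀ : ℝ),
    Measurable fun p : (Fin t → ℝ) × (Fin t → ℝ) => enc t m v₀ p.1 p.2
  measurable_dec : ∀ v₀ : ℝ, Measurable (dec v₀)

namespace FeedbackCode

variable {n : ℕ} (code : FeedbackCode n)

/-- The pair `((X_1, …, X_t), (Y_1, …, Y_t))` produced by the code when message `m` is sent and the
noise is `V`: `X_{t+1} = e_{t+1}(m, v₀, X^t, Y^t)` and `Y_{t+1} = X_{t+1} + V_{t+1}`. -/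
def history (m : Fin code.M) (v₀ : ℝ) (V : ℕ → ℝ) : (t : ℕ) → (Fin t → ℝ) × (Fin t → ℝ)
  | 0 => (Fin.elim0, Fin.elim0)
  | t + 1 =>
    let h := history m v₀ V t
    let x := code.enc t m v₀ h.1 h.2
    (Fin.snoc (α := fun _ => ℝ) h.1 x, Fin.snoc (α := fun _ => ℝ) h.2 (x + V (t + 1)))

/-- The probability law `P_{v₀}` of the pair (message, innovations): the message is uniformly
distributed and independent of the noise. -/
def law (KW : ℕ → ℝ≥0) : MeasureTheory.Measure (Fin code.M × (ℕ → ℝ)) :=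
  (ProbabilityTheory.uniformOn (Set.univ : Set (Fin code.M))).prod (innovLaw KW)

/-- The channel inputs `X^n` as random variables. -/
def input (c : ℕ → ℝ) (v₀ : ℝ) (ω : Fin code.M × (ℕ → ℝ)) : Fin n → ℝ :=
  (code.history ω.1 v₀ (arNoise c v₀ ω.2) n).1

/-- The channel outputs `Y^n` as random variables. -/
def output (c : ℕ → ℝ) (v₀ : ℝ) (ω : Fin code.M × (ℕ → ℝ)) : Fin n → ℝ :=
  (code.history ω.1 v₀ (arNoise c v₀ ω.2) n).2

/-- The average power constraint `(1/n) E_{v₀}[∑_{t=1}^n X_t²] ≤ κ`. -/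
def PowerConstraint (c : ℕ → ℝ) (KW : ℕ → ℝ≥0) (κ v₀ : ℝ) : Prop :=
  ∫⁻ ω, ENNReal.ofReal ((1 / (n : ℝ)) * ∑ i, code.input c v₀ ω i ^ 2) ∂(code.law KW)
    ≤ ENNReal.ofReal κ

/-- The average error probability `P_{v₀}(d_n(v₀, Y^n) ≠ W)`. -/
def errorProb (c : ℕ → ℝ) (KW : ℕ → ℝ≥0) (v₀ : ℝ) : ℝ :=
  (code.law KW).real {ω | code.dec v₀ (code.output c v₀ ω) ≠ ω.1}

/-- The coding rate `(1/n) log M`, in nats. -/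
def rate : ℝ := (1 / (n : ℝ)) * Real.log code.M

end FeedbackCode

/-- `R` is an achievable rate for the initial state `v₀` and power `κ`: there is a sequence of
feedback codes, one for every block length `n ≥ 1`, that satisfy the power constraint, have error
probability at most `ε_n → 0`, and have `liminf_n (1/n) log M_n ≥ R` (a limit inferior in the
extended reals). -/
def IsAchievableRate (c : ℕ → ℝ) (KW : ℕ → ℝ≥0) (κ v₀ R : ℝ) : Prop :=
  ∃ (code : (n : ℕ) → FeedbackCode n) (ε : ℕ → ℝ),
    (∀ n, 1 ≤ n → (code n).PowerConstraint c KW κ v₀ ∧ (code n).errorProb c KW v₀ ≤ ε n) ∧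
    Filter.Tendsto ε Filter.atTop (nhds 0) ∧
    (R : EReal) ≤ Filter.liminf (fun n => (((code n).rate : ℝ) : EReal)) Filter.atTop

/-! ### The finite-horizon feedback information capacity -/

/-- The solution `K_t` of the generalized difference Riccati equation for the strategy
`(Λ_t, K_{Z_t})`, started at `K_0 = 0`. -/
def riccati (c : ℕ → ℝ) (KW : ℕ → ℝ≥0) (Λ KZ : ℕ → ℝ) : ℕ → ℝ
  | 0 => 0
  | t + 1 =>
    let K := riccati c KW Λ KZ t
    c (t + 1) ^ 2 * K + KW (t + 1)
      - (KW (t + 1) + c (t + 1) * K * (Λ (t + 1) + c (t + 1))) ^ 2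
        / (KZ (t + 1) + KW (t + 1) + (Λ (t + 1) + c (t + 1)) ^ 2 * K)

/-- The strategy `(Λ_t, K_{Z_t})`, `t = 1, …, n`, is feasible: `K_{Z_t} ≥ 0`, the Riccati solution
is nonnegative, and `(1/n) ∑_{t=1}^n (Λ_t² K_{t-1} + K_{Z_t}) ≤ κ`. -/
def IsFeasible (c : ℕ → ℝ) (KW : ℕ → ℝ≥0) (κ : ℝ) (n : ℕ) (Λ KZ : ℕ → ℝ) : Prop :=
  (∀ t ∈ Finset.Icc 1 n, 0 ≤ KZ t) ∧
  (∀ t ∈ Finset.Icc 1 n, 0 ≤ riccati c KW Λ KZ t) ∧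
  (1 / (n : ℝ)) * ∑ t ∈ Finset.Icc 1 n, (Λ t ^ 2 * riccati c KW Λ KZ (t - 1) + KZ t) ≤ κ

/-- The objective
`(1/2) ∑_{t=1}^n log (((Λ_t + c_t)² K_{t-1} + K_{Z_t} + K_{W_t}) / K_{W_t})`. -/
def objective (c : ℕ → ℝ) (KW : ℕ → ℝ≥0) (n : ℕ) (Λ KZ : ℕ → ℝ) : ℝ :=
  (1 / 2) * ∑ t ∈ Finset.Icc 1 n,
    Real.log (((Λ t + c t) ^ 2 * riccati c KW Λ KZ (t - 1) + KZ t + KW t) / KW t)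

/-- The `n`-finite transmission feedback information capacity `C_n(κ, v₀)`; its value does not
depend on `v₀`. -/
def ftfiCapacity (c : ℕ → ℝ) (KW : ℕ → ℝ≥0) (κ : ℝ) (n : ℕ) : ℝ :=
  sSup {r : ℝ | ∃ Λ KZ : ℕ → ℝ, IsFeasible c KW κ n Λ KZ ∧ r = objective c KW n Λ KZ}

/-- `(Λ_t, K_{Z_t})`, `t = 1, …, n`, is a maximizing element of the problem defining `C_n`. -/
def IsMaximizer (c : ℕ → ℝ) (KW : ℕ → ℝ≥0) (κ : ℝ) (n : ℕ) (Λ KZ : ℕ → ℝ) : Prop :=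
  IsFeasible c KW κ n Λ KZ ∧
    ∀ Λ' KZ' : ℕ → ℝ, IsFeasible c KW κ n Λ' KZ' →
      objective c KW n Λ' KZ' ≤ objective c KW n Λ KZ

end AGN

end

/-! A change of measure does the work usually done by entropies. The law of the outputs given the
message is compared with one reference law, under which each output is Gaussian with variance `σ t`
about a prediction `L t` made from the past outputs. `infoDensity`, written ι here, is the logarithm
of the likelihood ratio: whatever the message, the weight exp(-ι) turns the law of the outputs into
the reference law (`lintegral_exp_neg_infoDensity`). The reference law does not depend on the
message, so under it a decoder is right with probability exactly 1/M. Hence (1 +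
M·1{correct})·exp(-ι) has mean at most 2, and log u ≤ u - 1 yields (1 - error) log M ≤ log 2 + E ι
(`one_sub_errorProb_mul_log_le`).

Now let `L t` be the best affine predictor and `σ t` its mean squared error. The quadratic terms of
E ι cancel, which leaves the sum of (1/2) log (σ / K_W) (`integral_infoDensity`). This depends on
second moments only, so the code may be non-linear and its inputs non-Gaussian.

What remains is Kalman filtering in L². Regress the part of the input not predicted by the past
outputs on the error in estimating the noise state. The regression coefficient is Λ, the residual
variance is K_Z, and the error variances then satisfy the Riccati equation, with no more power than
the code spends (`exists_strategy_of_linear_model`). So the sum is at most C_n; dividing by n and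
letting n tend to infinity gives the theorem. -/

namespace AGN

/-! ### Kalman filtering in an abstract Hilbert space -/

section LinearEstimation

open scoped InnerProductSpace

variable {H : Type*} [NormedAddCommGroup H] [InnerProductSpace ℝ H]

/-- The span of the constant `one` and of the first `t` observations. -/
noncomputable def observationSpace (one : H) (y : ℕ → H) : ℕ → Submodule ℝ H
  | 0 => Submodule.span ℝ {one}
  | t + 1 => observationSpace one y t ⊔ Submodule.span ℝ {y t}

instance finiteDimensional_observationSpace (one : H) (y : ℕ → H) (t : ℕ) :
    FiniteDimensional ℝ (observationSpace one y t) := by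
  induction t with
  | zero => exact inferInstanceAs (FiniteDimensional ℝ (Submodule.span ℝ {one}))
  | succ t ih =>
    exact inferInstanceAs
      (FiniteDimensional ℝ (observationSpace one y t ⊔ Submodule.span ℝ {y t} : Submodule ℝ H))

theorem norm_sq_innovation {d e w : H} (hwd : ⟪w, d⟫_ℝ = 0) (hwe : ⟪w, e⟫_ℝ = 0) (a : ℝ) :
    ‖d + a • e + w‖ ^ 2 = ‖d‖ ^ 2 + 2 * a * ⟪d, e⟫_ℝ + a ^ 2 * ‖e‖ ^ 2 + ‖w‖ ^ 2 := by
  simp only [← real_inner_self_eq_norm_sq, inner_add_left, inner_add_right, inner_smul_left,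
    inner_smul_right, hwd, hwe, real_inner_comm w d, real_inner_comm w e, real_inner_comm d e,
    RCLike.conj_to_real]
  ring

theorem inner_state_innovation {d e w : H} (hwd : ⟪w, d⟫_ℝ = 0) (hwe : ⟪w, e⟫_ℝ = 0) (a : ℝ) :
    ⟪a • e + w, d + a • e + w⟫_ℝ = a * ⟪d, e⟫_ℝ + a ^ 2 * ‖e‖ ^ 2 + ‖w‖ ^ 2 := by
  simp only [← real_inner_self_eq_norm_sq, inner_add_left, inner_add_right, inner_smul_left,
    inner_smul_right, hwd, hwe, real_inner_comm w e, real_inner_comm d e,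
    RCLike.conj_to_real]
  ring

theorem norm_sq_state {e w : H} (hwe : ⟪w, e⟫_ℝ = 0) (a : ℝ) :
    ‖a • e + w‖ ^ 2 = a ^ 2 * ‖e‖ ^ 2 + ‖w‖ ^ 2 := by
  simp only [← real_inner_self_eq_norm_sq, inner_add_left, inner_add_right, inner_smul_left,
    inner_smul_right, hwe, real_inner_comm w e, RCLike.conj_to_real]
  ring

/-- The squared error of the best linear estimate from one observation. -/
theorem norm_sq_sub_smul_inner_div (u i : H) :
    ‖u - (⟪u, i⟫_ℝ / ‖i‖ ^ 2) • i‖ ^ 2 = ‖u‖ ^ 2 - ⟪u, i⟫_ℝ ^ 2 / ‖i‖ ^ 2 := by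
  rw [norm_sub_sq_real, inner_smul_right, norm_smul, mul_pow, Real.norm_eq_abs, sq_abs]
  by_cases hi : i = 0
  · simp [hi]
  have : ‖i‖ ≠ 0 := norm_ne_zero_iff.2 hi
  field_simp
  ring

variable {one : H} {x y v w : ℕ → H} {n : ℕ} {c : ℕ → ℝ} {KW : ℕ → ℝ≥0} {v₀ : ℝ}

/-- The error of the linear estimate of the noise `v t` from the first `t` observations. -/
noncomputable def estimationError (one : H) (y v : ℕ → H) (t : ℕ) : H :=
  v t - (observationSpace one y t).starProjection (v t)

/-- The measurement update of the Kalman filter. The innovation of `z` spans what `z` adds to `S`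
and is orthogonal to `S`, so the projection gains only the component along it. -/
theorem starProjection_sup_span_singleton (S : Submodule ℝ H) [FiniteDimensional ℝ S]
    (u z : H) (hi : ‖z - S.starProjection z‖ ^ 2 ≠ 0) :
    (S ⊔ Submodule.span ℝ {z}).starProjection u = S.starProjection u +
      (⟪u - S.starProjection u, z - S.starProjection z⟫_ℝ / ‖z - S.starProjection z‖ ^ 2) •
        (z - S.starProjection z) := by
  set i := z - S.starProjection z with hidef
  set g := ⟪u - S.starProjection u, i⟫_ℝ / ‖i‖ ^ 2 with hg
  have hpS : ∀ r : H, S.starProjection r ∈ S := fun r => Submodule.starProjection_apply_mem S r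
  have horth : ∀ r : H, ∀ s ∈ S, ⟪r - S.starProjection r, s⟫_ℝ = 0 := fun r s hs =>
    Submodule.starProjection_inner_eq_zero r s hs
  have hiM : i ∈ S ⊔ Submodule.span ℝ {z} :=
    Submodule.sub_mem _ (Submodule.mem_sup_right (Submodule.mem_span_singleton_self z))
      (Submodule.mem_sup_left (hpS z))
  refine (Submodule.eq_starProjection_of_mem_of_inner_eq_zero
    (Submodule.add_mem _ (Submodule.mem_sup_left (hpS u)) (Submodule.smul_mem _ _ hiM)) ?_)
  intro s hs
  obtain ⟨s', hs', z', hz', rfl⟩ := Submodule.mem_sup.1 hs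
  obtain ⟨a, rfl⟩ := Submodule.mem_span_singleton.1 hz'
  have key : ∀ s ∈ S, ⟪u - (S.starProjection u + g • i), s⟫_ℝ = 0 := by
    intro s hs
    rw [← sub_sub, inner_sub_left, inner_smul_left, horth u s hs, horth z s hs]
    simp
  have hz : z = i + S.starProjection z := by simp [hidef]
  have keyi : ⟪u - (S.starProjection u + g • i), i⟫_ℝ = 0 := by
    rw [← sub_sub, inner_sub_left, inner_smul_left, real_inner_self_eq_norm_sq, hg,
      RCLike.conj_to_real, div_mul_cancel₀ _ hi, sub_self]
  have keyz : ⟪u - (S.starProjection u + g • i), z⟫_ℝ = 0 := by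
    have := key _ (hpS z)
    calc _ = ⟪u - (S.starProjection u + g • i), i + S.starProjection z⟫_ℝ := by rw [← hz]
      _ = 0 := by rw [inner_add_right, keyi, this, add_zero]
  rw [inner_add_right, key s' hs', inner_smul_right, keyz]
  simp

/-- Every linear model of the channel is reproduced, as far as second moments are concerned, by a
strategy `(Λ_t, K_{Z_t})`. -/
theorem exists_strategy_of_linear_model (hKW : ∀ t, 1 ≤ t → 0 < KW t)
    (hv0 : v 0 = v₀ • one)
    (hv : ∀ t < n, v (t + 1) = c (t + 1) • v t + w t)
    (hy : ∀ t < n, y t = x t + v (t + 1))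
    (hw : ∀ t < n, ‖w t‖ ^ 2 = KW (t + 1))
    (hwx : ∀ t < n, ⟪w t, x t⟫_ℝ = 0)
    (hwv : ∀ t < n, ⟪w t, v t⟫_ℝ = 0)
    (hwS : ∀ t < n, ∀ u ∈ observationSpace one y t, ⟪w t, u⟫_ℝ = 0) :
    ∃ Λ KZ : ℕ → ℝ, (∀ t < n, 0 ≤ KZ (t + 1)) ∧ (∀ t ≤ n, 0 ≤ riccati c KW Λ KZ t) ∧
      (∀ t < n, Λ (t + 1) ^ 2 * riccati c KW Λ KZ t + KZ (t + 1) ≤ ‖x t‖ ^ 2) ∧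
      ∀ t < n, (Λ (t + 1) + c (t + 1)) ^ 2 * riccati c KW Λ KZ t + KZ (t + 1) + KW (t + 1) =
        ‖y t - (observationSpace one y t).starProjection (y t)‖ ^ 2 := by
  set S := observationSpace one y with hS
  set e := estimationError one y v with he
  set d : ℕ → H := fun t => x t - (S t).starProjection (x t) with hd
  -- Strategies are indexed from time 1 and the vectors from 0, hence `t - 1`. If the estimation
  -- error vanishes, division by zero makes Λ zero, which is harmless.
  set Λ : ℕ → ℝ := fun t => ⟪d (t - 1), e (t - 1)⟫_ℝ / ‖e (t - 1)‖ ^ 2 with hΛ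
  set KZ : ℕ → ℝ := fun t => ‖d (t - 1)‖ ^ 2 - Λ t ^ 2 * ‖e (t - 1)‖ ^ 2 with hKZ
  have hpS : ∀ t (r : H), (S t).starProjection r ∈ S t := fun t r =>
    Submodule.starProjection_apply_mem _ r
  have hΛQ : ∀ t, Λ (t + 1) * ‖e t‖ ^ 2 = ⟪d t, e t⟫_ℝ := by
    intro t
    simp only [hΛ, Nat.add_sub_cancel]
    by_cases h : e t = 0
    · simp [h]
    · have : ‖e t‖ ^ 2 ≠ 0 := by positivity
      field_simp
  have hKZ0 : ∀ t, 0 ≤ KZ (t + 1) := by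
    intro t
    simp only [hKZ, Nat.add_sub_cancel, sub_nonneg]
    by_cases h : e t = 0
    · simp [h]
    · have h1 : 0 < ‖e t‖ ^ 2 := by positivity
      have h2 : Λ (t + 1) ^ 2 * ‖e t‖ ^ 2 = ⟪d t, e t⟫_ℝ ^ 2 / ‖e t‖ ^ 2 := by
        rw [← hΛQ t]; field_simp
      -- The residual variance of a regression is nonnegative by Cauchy–Schwarz.
      rw [h2, div_le_iff₀ h1, ← mul_pow]
      exact sq_le_sq' (by linarith [neg_abs_le ⟪d t, e t⟫_ℝ, abs_real_inner_le_norm (d t) (e t)])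
        (real_inner_le_norm _ _)
  have hwe : ∀ t < n, ⟪w t, e t⟫_ℝ = 0 := fun t ht => by
    simp only [he, estimationError, inner_sub_right, hwv t ht]
    rw [hwS t ht _ (hpS t _), sub_zero]
  have hwd : ∀ t < n, ⟪w t, d t⟫_ℝ = 0 := fun t ht => by
    simp only [hd, inner_sub_right, hwx t ht]
    rw [hwS t ht _ (hpS t _), sub_zero]
  have hPw : ∀ t < n, (S t).starProjection (w t) = 0 := fun t ht =>
    (Submodule.starProjection_apply_eq_zero_iff _).2
      ((Submodule.mem_orthogonal' _ _).2 (hwS t ht))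
  have hstate : ∀ t < n, v (t + 1) - (S t).starProjection (v (t + 1)) =
      c (t + 1) • e t + w t := fun t ht => by
    rw [hv t ht, map_add, map_smul, hPw t ht, add_zero]
    simp only [he, estimationError, ← hS, smul_sub]
    abel
  have hinn : ∀ t < n, y t - (S t).starProjection (y t) = d t + c (t + 1) • e t + w t :=
    fun t ht => by
    have := hstate t ht
    rw [add_assoc, ← this, hy t ht, map_add]
    simp only [hd]
    abel
  have hinnsq : ∀ t < n, ‖y t - (S t).starProjection (y t)‖ ^ 2 =
      (Λ (t + 1) + c (t + 1)) ^ 2 * ‖e t‖ ^ 2 + KZ (t + 1) + KW (t + 1) := fun t ht => by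
    rw [hinn t ht, norm_sq_innovation (hwd t ht) (hwe t ht), ← hΛQ t, hw t ht]
    simp only [hKZ, Nat.add_sub_cancel]
    ring
  have hpos : ∀ t < n, ‖y t - (S t).starProjection (y t)‖ ^ 2 ≠ 0 := fun t ht => by
    rw [hinnsq t ht]
    have := hKZ0 t
    have h3 : (0 : ℝ) < KW (t + 1) := by exact_mod_cast hKW (t + 1) (by omega)
    positivity
  have hric : ∀ t ≤ n, riccati c KW Λ KZ t = ‖e t‖ ^ 2 := by
    intro t
    induction t with
    | zero =>
      intro _
      -- The known initial state is a multiple of the constant, which is already in the observation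
      -- space; this matches K_0 = 0.
      have : e 0 = 0 := by
        simp only [he, estimationError, hv0, sub_eq_zero]
        refine (Submodule.starProjection_eq_self_iff.2 ?_).symm
        exact Submodule.smul_mem _ _ (Submodule.mem_span_singleton_self one)
      simp [riccati, this]
    | succ t ih =>
      intro ht
      have ht' : t < n := by omega
      -- The new error is the predicted state error minus its projection on the innovation; its
      -- squared norm is the right side of the Riccati equation.
      have he' : e (t + 1) = (c (t + 1) • e t + w t) -
          (⟪c (t + 1) • e t + w t, d t + c (t + 1) • e t + w t⟫_ℝ /
            ‖d t + c (t + 1) • e t + w t‖ ^ 2) • (d t + c (t + 1) • e t + w t) := by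
        have := starProjection_sup_span_singleton (S t) (v (t + 1)) (y t) (hpos t ht')
        rw [hstate t ht', hinn t ht'] at this
        rw [← hstate t ht'] at this ⊢
        have h4 : e (t + 1) = v (t + 1) - (S t ⊔ Submodule.span ℝ {y t}).starProjection
          (v (t + 1)) := rfl
        rw [h4, this]
        abel
      have hne := hpos t ht'
      have hsq := hinnsq t ht'
      rw [hinn t ht'] at hne hsq
      rw [he', norm_sq_sub_smul_inner_div, norm_sq_state (hwe t ht'),
        inner_state_innovation (hwd t ht') (hwe t ht'), hsq, ← hΛQ t, hw t ht']
      simp only [riccati, ih (by omega)]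
      congr 2 <;> ring
  refine ⟨Λ, KZ, fun t _ => hKZ0 t, fun t ht => ?_, fun t ht => ?_, fun t ht => ?_⟩
  · rw [hric t ht]; positivity
  · rw [hric t ht.le]
    -- The power of the strategy collapses to ‖d t‖², and `d t` is an orthogonal projection of the
    -- input.
    simp only [hKZ, Nat.add_sub_cancel, add_sub_cancel]
    have h5 : ‖d t‖ ≤ ‖x t‖ := by
      have : d t = (S t)ᗮ.starProjection (x t) := by
        rw [Submodule.starProjection_orthogonal_val]
      rw [this]
      exact Submodule.norm_starProjection_apply_le _ _
    exact pow_le_pow_left₀ (norm_nonneg _) h5 2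
  · rw [hric t ht.le, hinnsq t ht]

/-- The innovations of a linear model with input power at most `κ` carry at most `C_n`. -/
theorem sum_log_innovation_le_ftfiCapacity (hKW : ∀ t, 1 ≤ t → 0 < KW t) {κ : ℝ}
    (hC : ∃ Λ KZ : ℕ → ℝ, IsMaximizer c KW κ n Λ KZ)
    (hv0 : v 0 = v₀ • one)
    (hv : ∀ t < n, v (t + 1) = c (t + 1) • v t + w t)
    (hy : ∀ t < n, y t = x t + v (t + 1))
    (hw : ∀ t < n, ‖w t‖ ^ 2 = KW (t + 1))
    (hwx : ∀ t < n, ⟪w t, x t⟫_ℝ = 0)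
    (hwv : ∀ t < n, ⟪w t, v t⟫_ℝ = 0)
    (hwS : ∀ t < n, ∀ u ∈ observationSpace one y t, ⟪w t, u⟫_ℝ = 0)
    (hx : (1 / (n : ℝ)) * ∑ t ∈ Finset.range n, ‖x t‖ ^ 2 ≤ κ) :
    (∀ t < n, (KW (t + 1) : ℝ) ≤ ‖y t - (observationSpace one y t).starProjection (y t)‖ ^ 2) ∧
    ∑ t ∈ Finset.range n, (1 / 2) * Real.log
      (‖y t - (observationSpace one y t).starProjection (y t)‖ ^ 2 / KW (t + 1)) ≤
        ftfiCapacity c KW κ n := by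
  obtain ⟨Λ, KZ, h1, h2, h3, h4⟩ :=
    exists_strategy_of_linear_model hKW hv0 hv hy hw hwx hwv hwS
  have hshift : ∀ f : ℕ → ℝ, ∑ t ∈ Finset.Icc 1 n, f t = ∑ t ∈ Finset.range n, f (t + 1) := by
    intro f
    rw [Finset.range_eq_Ico, Finset.sum_Ico_add' f 0 n 1]
    rfl
  have hfeas : IsFeasible c KW κ n Λ KZ := by
    refine ⟨fun t ht => ?_, fun t ht => h2 t (Finset.mem_Icc.1 ht).2, ?_⟩
    · obtain ⟨a, b⟩ := Finset.mem_Icc.1 ht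
      obtain ⟨s, rfl⟩ := Nat.exists_eq_add_of_le' a
      exact h1 s (by omega)
    · refine le_trans ?_ hx
      rw [hshift]
      gcongr with t ht
      exact h3 t (Finset.mem_range.1 ht)
  have hobj : ∑ t ∈ Finset.range n, (1 / 2) * Real.log
      (‖y t - (observationSpace one y t).starProjection (y t)‖ ^ 2 / KW (t + 1)) =
      objective c KW n Λ KZ := by
    rw [objective, hshift, Finset.mul_sum]
    refine Finset.sum_congr rfl fun t ht => ?_
    rw [← h4 t (Finset.mem_range.1 ht), Nat.add_sub_cancel]
  constructor
  · intro t ht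
    rw [← h4 t ht]
    have := h1 t ht
    have := h2 t ht.le
    have : 0 ≤ (Λ (t + 1) + c (t + 1)) ^ 2 * riccati c KW Λ KZ t := by positivity
    linarith
  -- The maximizer serves to bound the set of objective values above, without which the real `sSup`
  -- would carry no information.
  · obtain ⟨Λ', KZ', -, hmax⟩ := hC
    rw [hobj]
    refine le_csSup ⟨objective c KW n Λ' KZ', ?_⟩ ⟨Λ, KZ, hfeas, rfl⟩
    rintro r ⟨Λ'', KZ'', hf, rfl⟩
    exact hmax _ _ hf

end LinearEstimation

section Model

open MeasureTheory ProbabilityTheory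

open scoped ENNReal

variable {n : ℕ} (code : FeedbackCode n) (c : ℕ → ℝ) (KW : ℕ → ℝ≥0) (v₀ : ℝ)

/-! ### The random variables of a feedback code -/

/-- The channel input at time `t + 1`. -/
def channelInput (t : ℕ) (ω : Fin code.M × (ℕ → ℝ)) : ℝ :=
  code.enc t ω.1 v₀ (code.history ω.1 v₀ (arNoise c v₀ ω.2) t).1
    (code.history ω.1 v₀ (arNoise c v₀ ω.2) t).2

/-- The channel output at time `t + 1`. -/
def channelOutput (t : ℕ) (ω : Fin code.M × (ℕ → ℝ)) : ℝ :=
  channelInput code c v₀ t ω + arNoise c v₀ ω.2 (t + 1)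

/-- The first `t` channel outputs. -/
def outputHistory (t : ℕ) (ω : Fin code.M × (ℕ → ℝ)) : Fin t → ℝ :=
  (code.history ω.1 v₀ (arNoise c v₀ ω.2) t).2

theorem outputHistory_succ (t : ℕ) (ω : Fin code.M × (ℕ → ℝ)) :
    outputHistory code c v₀ (t + 1) ω =
      Fin.snoc (α := fun _ => ℝ) (outputHistory code c v₀ t ω) (channelOutput code c v₀ t ω) :=
  rfl

theorem history_fst_apply (t : ℕ) (ω : Fin code.M × (ℕ → ℝ)) (i : Fin t) :
    (code.history ω.1 v₀ (arNoise c v₀ ω.2) t).1 i = channelInput code c v₀ i ω := by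
  induction t with
  | zero => exact i.elim0
  | succ t ih =>
    change Fin.snoc (α := fun _ => ℝ) (code.history ω.1 v₀ (arNoise c v₀ ω.2) t).1
      (channelInput code c v₀ t ω) i = _
    refine Fin.lastCases ?_ (fun j => ?_) i
    · simp
    · simp [ih]

theorem sum_input_sq (ω : Fin code.M × (ℕ → ℝ)) :
    ∑ i, code.input c v₀ ω i ^ 2 = ∑ t ∈ Finset.range n, channelInput code c v₀ t ω ^ 2 := by
  rw [Finset.sum_range]
  exact Finset.sum_congr rfl fun i _ => by rw [FeedbackCode.input, history_fst_apply]

/-! ### Dependence on the innovations -/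

theorem arNoise_update {t s : ℕ} (hts : t < s) (w : ℕ → ℝ) (z : ℝ) :
    arNoise c v₀ (Function.update w s z) t = arNoise c v₀ w t := by
  induction t with
  | zero => rfl
  | succ t ih =>
    rw [arNoise, arNoise, ih (by omega), Function.update_of_ne (by omega)]

/-- Causality: the first `t` inputs and outputs involve no innovation later than time `t`. -/
theorem history_update {t s : ℕ} (hts : t < s) (m : Fin code.M) (w : ℕ → ℝ) (z : ℝ) :
    code.history m v₀ (arNoise c v₀ (Function.update w s z)) t =
      code.history m v₀ (arNoise c v₀ w) t := by
  induction t with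
  | zero => rfl
  | succ t ih =>
    simp only [FeedbackCode.history, ih (by omega), arNoise_update c v₀ hts]

theorem channelInput_update {t s : ℕ} (hts : t < s) (m : Fin code.M) (w : ℕ → ℝ) (z : ℝ) :
    channelInput code c v₀ t (m, Function.update w s z) = channelInput code c v₀ t (m, w) := by
  simp only [channelInput, history_update code c v₀ hts]

theorem channelOutput_update {t s : ℕ} (hts : t + 1 < s) (m : Fin code.M) (w : ℕ → ℝ) (z : ℝ) :
    channelOutput code c v₀ t (m, Function.update w s z) = channelOutput code c v₀ t (m, w) := by
  simp only [channelOutput, channelInput_update code c v₀ (show t < s by omega),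
    arNoise_update c v₀ hts]

theorem outputHistory_update {t s : ℕ} (hts : t < s) (m : Fin code.M) (w : ℕ → ℝ) (z : ℝ) :
    outputHistory code c v₀ t (m, Function.update w s z) = outputHistory code c v₀ t (m, w) := by
  simp only [outputHistory, history_update code c v₀ hts]

/-! ### Measurability -/

theorem measurable_arNoise (t : ℕ) : Measurable fun w : ℕ → ℝ => arNoise c v₀ w t := by
  induction t with
  | zero => exact measurable_const
  | succ t ih => exact (ih.const_mul _).add (measurable_pi_apply _)

theorem measurable_finSnoc (t : ℕ) :
    Measurable fun p : (Fin t → ℝ) × ℝ => (Fin.snoc (α := fun _ => ℝ) p.1 p.2 : Fin (t + 1) → ℝ) := by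
  refine measurable_pi_iff.2 fun i => ?_
  refine Fin.lastCases ?_ (fun j => ?_) i
  · simpa using measurable_snd
  · simp only [Fin.snoc_castSucc]; fun_prop

theorem measurable_history (m : Fin code.M) {t : ℕ} (ht : t ≤ n) :
    Measurable fun w : ℕ → ℝ => code.history m v₀ (arNoise c v₀ w) t := by
  induction t with
  | zero => exact measurable_const
  | succ t ih =>
    have ih := ih (by omega)
    have hx := (code.measurable_enc t (by omega) m v₀).comp ih
    exact ((measurable_finSnoc t).comp (ih.fst.prodMk hx)).prodMk
      ((measurable_finSnoc t).comp (ih.snd.prodMk (hx.add (measurable_arNoise c v₀ (t + 1)))))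

theorem measurable_outputHistory {t : ℕ} (ht : t ≤ n) :
    Measurable (outputHistory code c v₀ t) :=
  measurable_from_prod_countable_right fun m => (measurable_history code c v₀ m ht).snd

theorem measurable_channelInput {t : ℕ} (ht : t < n) : Measurable (channelInput code c v₀ t) :=
  measurable_from_prod_countable_right fun m =>
    (code.measurable_enc t ht m v₀).comp (measurable_history code c v₀ m ht.le)

theorem measurable_channelOutput {t : ℕ} (ht : t < n) : Measurable (channelOutput code c v₀ t) :=
  (measurable_channelInput code c v₀ ht).add ((measurable_arNoise c v₀ (t + 1)).comp measurable_snd)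

/-! ### Resampling one innovation -/

instance isProbabilityMeasure_innovLaw : IsProbabilityMeasure (innovLaw KW) := by
  unfold innovLaw; infer_instance

theorem measurable_update_prod (s : ℕ) :
    Measurable fun p : (ℕ → ℝ) × ℝ => Function.update p.1 s p.2 := by
  refine measurable_pi_iff.2 fun i => ?_
  by_cases h : i = s
  · subst h; simpa using measurable_snd
  · simp only [Function.update_of_ne h]; fun_prop

/-- Replacing one coordinate by an independent copy preserves a product measure; it suffices to
compare both sides on finite-dimensional boxes. -/
theorem map_update_innovLaw (s : ℕ) :
    ((innovLaw KW).prod (gaussianReal 0 (KW s))).map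
      (fun p : (ℕ → ℝ) × ℝ => Function.update p.1 s p.2) = innovLaw KW := by
  refine Measure.eq_infinitePi _ fun A B hB => ?_
  rw [Measure.map_apply (measurable_update_prod s)
    (MeasurableSet.pi A.countable_toSet fun i _ => hB i)]
  by_cases hs : s ∈ A
  · have : (fun p : (ℕ → ℝ) × ℝ => Function.update p.1 s p.2) ⁻¹' Set.pi A B =
        Set.pi (A.erase s) B ×ˢ B s := by
      ext p
      simp only [Set.mem_preimage, Set.mem_pi, Set.mem_prod, Finset.mem_coe, Finset.mem_erase]
      constructor
      · intro h
        refine ⟨fun i hi => ?_, by simpa using h s hs⟩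
        simpa [Function.update_of_ne hi.1] using h i hi.2
      · rintro ⟨h1, h2⟩ i hi
        by_cases his : i = s
        · subst his; simpa using h2
        · simpa [Function.update_of_ne his] using h1 i ⟨his, hi⟩
    rw [this, Measure.prod_prod, innovLaw, Measure.infinitePi_pi _ (fun i _ => hB i),
      Finset.prod_erase_mul _ _ hs]
  · have : (fun p : (ℕ → ℝ) × ℝ => Function.update p.1 s p.2) ⁻¹' Set.pi A B =
        Set.pi A B ×ˢ Set.univ := by
      ext p
      simp only [Set.mem_preimage, Set.mem_pi, Set.mem_prod, Finset.mem_coe, Set.mem_univ, and_true]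
      refine forall₂_congr fun i hi => ?_
      rw [Function.update_of_ne (by rintro rfl; exact hs hi)]
    rw [this, Measure.prod_prod, innovLaw, Measure.infinitePi_pi _ (fun i _ => hB i), measure_univ,
      mul_one]

/-- Stands in for conditioning on all the other innovations: the one at time `s` can be integrated
first, with the rest frozen. -/
theorem lintegral_innovLaw_update (s : ℕ) {F : (ℕ → ℝ) → ℝ≥0∞} (hF : Measurable F) :
    ∫⁻ w, F w ∂innovLaw KW =
      ∫⁻ w, ∫⁻ z, F (Function.update w s z) ∂gaussianReal 0 (KW s) ∂innovLaw KW := by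
  conv_lhs => rw [← map_update_innovLaw KW s]
  rw [lintegral_map hF (measurable_update_prod s),
    lintegral_prod (fun p : (ℕ → ℝ) × ℝ => F (Function.update p.1 s p.2))
      (hF.comp (measurable_update_prod s)).aemeasurable]

/-! ### Gaussian change of measure -/

theorem gaussianPDFReal_mul_exp {K σ : ℝ≥0} (hK : 0 < K) (hσ : 0 < σ) (z u : ℝ) :
    gaussianPDFReal 0 K z * Real.exp (-((1 / 2) * Real.log (σ / K) - z ^ 2 / (2 * K) +
      u ^ 2 / (2 * σ))) = gaussianPDFReal 0 σ u := by
  have hK' : (0 : ℝ) < K := hK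
  have hσ' : (0 : ℝ) < σ := hσ
  have h1 : Real.exp (-((1 / 2) * Real.log (σ / K))) = √K / √σ := by
    rw [show -((1 / 2) * Real.log ((σ : ℝ) / K)) = (1 / 2) * Real.log (K / σ) by
      rw [Real.log_div hσ'.ne' hK'.ne', Real.log_div hK'.ne' hσ'.ne']; ring]
    rw [← Real.sqrt_div hK'.le, Real.sqrt_eq_rpow, Real.rpow_def_of_pos (by positivity), mul_comm]
  rw [show -((1 / 2) * Real.log ((σ : ℝ) / K) - z ^ 2 / (2 * K) + u ^ 2 / (2 * σ)) =
    -((1 / 2) * Real.log (σ / K)) + (z ^ 2 / (2 * K) + -u ^ 2 / (2 * σ)) by ring,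
    Real.exp_add, Real.exp_add, h1, gaussianPDFReal, gaussianPDFReal, sub_zero, sub_zero,
    Real.sqrt_mul (show 0 ≤ 2 * Real.pi by positivity) K,
    Real.sqrt_mul (show 0 ≤ 2 * Real.pi by positivity) σ]
  have h2 : Real.exp (-z ^ 2 / (2 * K)) * Real.exp (z ^ 2 / (2 * K)) = 1 := by
    rw [← Real.exp_add, neg_div, neg_add_cancel, Real.exp_zero]
  have h3 : √(K : ℝ) ≠ 0 := by positivity
  have h4 : √(σ : ℝ) ≠ 0 := by positivity
  calc _ = (Real.exp (-z ^ 2 / (2 * K)) * Real.exp (z ^ 2 / (2 * K))) *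
        ((√(2 * Real.pi) * √K)⁻¹ * (√K / √σ) * Real.exp (-u ^ 2 / (2 * σ))) := by
        generalize √(2 * Real.pi) = r
        ring
    _ = _ := by
      rw [h2, one_mul]
      congr 1
      have h5 : √(2 * Real.pi) ≠ 0 := by positivity
      field_simp

/-- The exponential is the ratio of the N(l, σ) density to the N(a, K) density at the point a + z,
so both sides agree after the translation z ↦ a - l + z. -/
theorem lintegral_gaussianReal_tilt {K σ : ℝ≥0} (hK : 0 < K) (hσ : 0 < σ) (a l : ℝ)
    {g : ℝ → ℝ≥0∞} (hg : Measurable g) :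
    ∫⁻ z, g (a + z) * ENNReal.ofReal (Real.exp (-((1 / 2) * Real.log (σ / K) - z ^ 2 / (2 * K) +
      (a + z - l) ^ 2 / (2 * σ)))) ∂gaussianReal 0 K = ∫⁻ z, g (l + z) ∂gaussianReal 0 σ := by
  rw [gaussianReal_of_var_ne_zero _ hK.ne', gaussianReal_of_var_ne_zero _ hσ.ne',
    lintegral_withDensity_eq_lintegral_mul _ (measurable_gaussianPDF _ _) (by fun_prop),
    lintegral_withDensity_eq_lintegral_mul _ (measurable_gaussianPDF _ _) (by fun_prop)]
  have h : ∀ z, (gaussianPDF 0 K * fun z => g (a + z) * ENNReal.ofReal (Real.exp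
      (-((1 / 2) * Real.log (σ / K) - z ^ 2 / (2 * K) + (a + z - l) ^ 2 / (2 * σ))))) z =
      (fun z => gaussianPDF 0 σ z * g (l + z)) (a - l + z) := by
    intro z
    simp only [Pi.mul_apply]
    rw [mul_left_comm, gaussianPDF, ← ENNReal.ofReal_mul (gaussianPDFReal_nonneg _ _ _),
      gaussianPDFReal_mul_exp hK hσ, mul_comm, gaussianPDF]
    congr 2 <;> ring_nf
  simp_rw [h]
  exact lintegral_add_left_eq_self (fun z => gaussianPDF 0 σ z * g (l + z)) (a - l)

/-! ### The reference law of the outputs -/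

/-- The law of a process with independent `N(0, σ_t)` innovations around the predictions `L`. -/
noncomputable def predictionLaw (σ : ℕ → ℝ≥0) (L : (t : ℕ) → (Fin t → ℝ) → ℝ) :
    (t : ℕ) → Measure (Fin t → ℝ)
  | 0 => Measure.dirac Fin.elim0
  | t + 1 => ((predictionLaw σ L t).prod (gaussianReal 0 (σ t))).map
      fun p => Fin.snoc (α := fun _ => ℝ) p.1 (L t p.1 + p.2)

variable {σ : ℕ → ℝ≥0} {L : (t : ℕ) → (Fin t → ℝ) → ℝ}

theorem measurable_snoc_prediction (hL : ∀ t, Measurable (L t)) (t : ℕ) :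
    Measurable fun p : (Fin t → ℝ) × ℝ =>
      (Fin.snoc (α := fun _ => ℝ) p.1 (L t p.1 + p.2) : Fin (t + 1) → ℝ) :=
  (measurable_finSnoc t).comp
    (measurable_fst.prodMk (((hL t).comp measurable_fst).add measurable_snd))

theorem isProbabilityMeasure_predictionLaw (hL : ∀ t, Measurable (L t)) (t : ℕ) :
    IsProbabilityMeasure (predictionLaw σ L t) := by
  induction t with
  | zero => unfold predictionLaw; infer_instance
  | succ t ih =>
    unfold predictionLaw
    exact Measure.isProbabilityMeasure_map (measurable_snoc_prediction hL t).aemeasurable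

/-- The logarithm of the ratio of the density of the first `t` outputs given the message and the
density of the prediction law. -/
noncomputable def infoDensity (σ : ℕ → ℝ≥0) (L : (t : ℕ) → (Fin t → ℝ) → ℝ) (t : ℕ)
    (ω : Fin code.M × (ℕ → ℝ)) : ℝ :=
  ∑ s ∈ Finset.range t, ((1 / 2) * Real.log (σ s / KW (s + 1)) - ω.2 (s + 1) ^ 2 / (2 * KW (s + 1)) +
    (channelOutput code c v₀ s ω - L s (outputHistory code c v₀ s ω)) ^ 2 / (2 * σ s))

theorem infoDensity_update {t s : ℕ} (hts : t < s) (m : Fin code.M) (w : ℕ → ℝ) (z : ℝ) :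
    infoDensity code c KW v₀ σ L t (m, Function.update w s z) =
      infoDensity code c KW v₀ σ L t (m, w) := by
  refine Finset.sum_congr rfl fun r hr => ?_
  have hr := Finset.mem_range.1 hr
  rw [channelOutput_update code c v₀ (by omega), outputHistory_update code c v₀ (by omega)]
  simp only [Function.update_of_ne (show r + 1 ≠ s by omega)]

theorem measurable_infoDensity (hL : ∀ t, Measurable (L t)) {t : ℕ} (ht : t ≤ n) :
    Measurable (infoDensity code c KW v₀ σ L t) := by
  refine Finset.measurable_sum _ fun s hs => ?_
  have hs := Finset.mem_range.1 hs
  have h1 := measurable_channelOutput code c v₀ (show s < n by omega)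
  have h2 := (hL s).comp (measurable_outputHistory code c v₀ (show s ≤ n by omega))
  have h3 : Measurable fun ω : Fin code.M × (ℕ → ℝ) => ω.2 (s + 1) :=
    (measurable_pi_apply _).comp measurable_snd
  exact ((h3.pow_const 2).div_const _ |>.const_sub _).add (((h1.sub h2).pow_const 2).div_const _)

/-- By induction on time: given the past, resample the latest innovation and apply the one-step
Gaussian tilt. The right side is free of `m`, which is what the decoding bound exploits. -/
theorem lintegral_exp_neg_infoDensity (hKW : ∀ t, 1 ≤ t → 0 < KW t) (hσ : ∀ t < n, 0 < σ t)
    (hL : ∀ t, Measurable (L t)) (m : Fin code.M) {t : ℕ} (ht : t ≤ n)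
    {g : (Fin t → ℝ) → ℝ≥0∞} (hg : Measurable g) :
    ∫⁻ w, g (outputHistory code c v₀ t (m, w)) *
      ENNReal.ofReal (Real.exp (-infoDensity code c KW v₀ σ L t (m, w))) ∂innovLaw KW =
      ∫⁻ y, g y ∂predictionLaw σ L t := by
  induction t with
  | zero =>
    have : ∀ ω, outputHistory code c v₀ 0 ω = Fin.elim0 := fun ω => rfl
    simp [infoDensity, predictionLaw, this]
  | succ t ih =>
    have htn : t < n := by omega
    have hm : Measurable fun w : ℕ → ℝ => (m, w) := measurable_prodMk_left
    have hsm := measurable_snoc_prediction hL t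
    have := isProbabilityMeasure_predictionLaw (σ := σ) hL t
    have hF : Measurable fun w : ℕ → ℝ => g (outputHistory code c v₀ (t + 1) (m, w)) *
        ENNReal.ofReal (Real.exp (-infoDensity code c KW v₀ σ L (t + 1) (m, w))) :=
      (hg.comp ((measurable_outputHistory code c v₀ ht).comp hm)).mul
        ((measurable_infoDensity code c KW v₀ hL ht).comp hm).neg.exp.ennreal_ofReal
    rw [lintegral_innovLaw_update KW (t + 1) hF]
    have hinner : ∀ w : ℕ → ℝ,
        ∫⁻ z, g (outputHistory code c v₀ (t + 1) (m, Function.update w (t + 1) z)) *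
          ENNReal.ofReal (Real.exp (-infoDensity code c KW v₀ σ L (t + 1)
            (m, Function.update w (t + 1) z))) ∂gaussianReal 0 (KW (t + 1)) =
        (∫⁻ z, g (Fin.snoc (α := fun _ => ℝ) (outputHistory code c v₀ t (m, w))
          (L t (outputHistory code c v₀ t (m, w)) + z)) ∂gaussianReal 0 (σ t)) *
          ENNReal.ofReal (Real.exp (-infoDensity code c KW v₀ σ L t (m, w))) := by
      intro w
      set y := outputHistory code c v₀ t (m, w) with hy
      -- The part of the new output fixed by the message and the earlier innovations; the new
      -- innovation is then added to it.
      set a := channelInput code c v₀ t (m, w) + c (t + 1) * arNoise c v₀ w t with ha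
      have hout : ∀ z, channelOutput code c v₀ t (m, Function.update w (t + 1) z) = a + z := by
        intro z
        rw [channelOutput, channelInput_update code c v₀ (Nat.lt_succ_self t), arNoise,
          arNoise_update c v₀ (Nat.lt_succ_self t), ha, add_assoc]
        simp only [Function.update_self]
      have hg' : Measurable fun u : ℝ =>
          g (Fin.snoc (α := fun _ => ℝ) y u) :=
        hg.comp ((measurable_finSnoc t).comp measurable_prodMk_left)
      rw [← lintegral_gaussianReal_tilt (hKW (t + 1) (by omega)) (hσ t htn) a (L t y) hg',
        ← lintegral_mul_const _ (by fun_prop)]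
      refine lintegral_congr fun z => ?_
      rw [infoDensity, Finset.sum_range_succ, ← infoDensity,
        infoDensity_update code c KW v₀ (Nat.lt_succ_self t), outputHistory_succ, hout,
        outputHistory_update code c v₀ (Nat.lt_succ_self t), ← hy, neg_add, Real.exp_add,
        ENNReal.ofReal_mul (Real.exp_pos _).le]
      simp only [Function.update_self]
      ring
    simp_rw [hinner]
    have hg2 : Measurable fun y : Fin t → ℝ =>
        ∫⁻ z, g (Fin.snoc (α := fun _ => ℝ) y (L t y + z)) ∂gaussianReal 0 (σ t) :=
      (hg.comp hsm).lintegral_prod_right'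
    rw [ih htn.le hg2, predictionLaw, lintegral_map hg hsm,
      lintegral_prod (fun p : (Fin t → ℝ) × ℝ => g (Fin.snoc (α := fun _ => ℝ) p.1 (L t p.1 + p.2)))
        (hg.comp hsm).aemeasurable]

end Model

section Converse

open MeasureTheory ProbabilityTheory

open scoped ENNReal InnerProductSpace

variable {n : ℕ} (code : FeedbackCode n) (c : ℕ → ℝ) (KW : ℕ → ℝ≥0) (v₀ : ℝ)

theorem nonempty_message : Nonempty (Fin code.M) := ⟨code.dec 0 0⟩

theorem card_message_pos : 0 < code.M := Fin.pos_iff_nonempty.2 (nonempty_message code)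

instance isProbabilityMeasure_uniformOn_message :
    IsProbabilityMeasure (uniformOn (Set.univ : Set (Fin code.M))) := by
  have := nonempty_message code
  exact isProbabilityMeasure_uniformOn Set.finite_univ Set.univ_nonempty

instance isProbabilityMeasure_law : IsProbabilityMeasure (code.law KW) := by
  unfold FeedbackCode.law; infer_instance

theorem uniformOn_message_singleton (m : Fin code.M) :
    uniformOn (Set.univ : Set (Fin code.M)) {m} = (code.M : ℝ≥0∞)⁻¹ := by
  rw [uniformOn_univ, Measure.count_singleton]
  simp

/-! ### Fano's inequality in terms of the information density -/

variable {σ : ℕ → ℝ≥0} {L : (t : ℕ) → (Fin t → ℝ) → ℝ}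

/-- After the change of measure, message `m` contributes 1 + M·Q(decoding region of `m`), with Q the
reference law. The regions partition the output space, so the average over messages is 1 + 1. -/
theorem lintegral_decoding_exp_neg_infoDensity_le (hKW : ∀ t, 1 ≤ t → 0 < KW t)
    (hσ : ∀ t < n, 0 < σ t) (hL : ∀ t, Measurable (L t)) :
    ∫⁻ ω, (1 + (code.M : ℝ≥0∞) * Set.indicator {ω | code.dec v₀ (code.output c v₀ ω) = ω.1} 1 ω) *
      ENNReal.ofReal (Real.exp (-infoDensity code c KW v₀ σ L n ω)) ∂code.law KW ≤ 2 := by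
  have hdec := code.measurable_dec v₀
  have hout := measurable_outputHistory code c v₀ le_rfl
  have hA : MeasurableSet {ω | code.dec v₀ (code.output c v₀ ω) = ω.1} :=
    measurableSet_eq_fun (hdec.comp hout) measurable_fst
  have hmeas : Measurable fun ω => (1 + (code.M : ℝ≥0∞) *
      Set.indicator {ω | code.dec v₀ (code.output c v₀ ω) = ω.1} 1 ω) *
      ENNReal.ofReal (Real.exp (-infoDensity code c KW v₀ σ L n ω)) :=
    (((measurable_one.indicator hA).const_mul _).const_add _).mul
      (measurable_infoDensity code c KW v₀ hL le_rfl).neg.exp.ennreal_ofReal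
  have := isProbabilityMeasure_predictionLaw (σ := σ) hL n
  have hmsg : ∀ m : Fin code.M, ∫⁻ w, (1 + (code.M : ℝ≥0∞) *
      Set.indicator {ω | code.dec v₀ (code.output c v₀ ω) = ω.1} 1 (m, w)) *
      ENNReal.ofReal (Real.exp (-infoDensity code c KW v₀ σ L n (m, w))) ∂innovLaw KW =
      1 + code.M * predictionLaw σ L n (code.dec v₀ ⁻¹' {m}) := by
    intro m
    have hB : MeasurableSet (code.dec v₀ ⁻¹' {m}) := hdec (measurableSet_singleton m)
    have hg : Measurable fun y : Fin n → ℝ =>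
        1 + (code.M : ℝ≥0∞) * Set.indicator (code.dec v₀ ⁻¹' {m}) 1 y :=
      ((measurable_one.indicator hB).const_mul _).const_add _
    refine (lintegral_exp_neg_infoDensity code c KW v₀ hKW hσ hL m le_rfl hg).trans ?_
    rw [lintegral_add_left measurable_const, lintegral_const_mul _ (measurable_one.indicator hB),
      lintegral_indicator_one hB]
    simp
  rw [FeedbackCode.law, lintegral_prod _ hmeas.aemeasurable]
  rw [lintegral_congr hmsg, lintegral_add_left measurable_const, lintegral_one,
    measure_univ, lintegral_fintype]
  simp_rw [uniformOn_message_singleton]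
  have hM : (code.M : ℝ≥0∞) ≠ 0 := by exact_mod_cast (card_message_pos code).ne'
  have h1 : ∀ m : Fin code.M, (code.M : ℝ≥0∞) * predictionLaw σ L n (code.dec v₀ ⁻¹' {m}) *
      (code.M : ℝ≥0∞)⁻¹ = predictionLaw σ L n (code.dec v₀ ⁻¹' {m}) := by
    intro m
    rw [mul_right_comm, ENNReal.mul_inv_cancel hM (ENNReal.natCast_ne_top _), one_mul]
  rw [Finset.sum_congr rfl fun m _ => h1 m]
  rw [sum_measure_preimage_singleton _ fun m _ => hdec (measurableSet_singleton m)]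
  simp [one_add_one_eq_two]

/-- A Fano-type bound in the spirit of Donsker–Varadhan: the mean of f - ι is at most the logarithm
of the mean of exp(f - ι), where f equals log M on correct decoding and 0 elsewhere. -/
theorem one_sub_errorProb_mul_log_le (hKW : ∀ t, 1 ≤ t → 0 < KW t)
    (hσ : ∀ t < n, 0 < σ t) (hL : ∀ t, Measurable (L t))
    (hint : Integrable (infoDensity code c KW v₀ σ L n) (code.law KW)) :
    (1 - code.errorProb c KW v₀) * Real.log code.M ≤
      Real.log 2 + ∫ ω, infoDensity code c KW v₀ σ L n ω ∂code.law KW := by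
  set A : Set (Fin code.M × (ℕ → ℝ)) := {ω | code.dec v₀ (code.output c v₀ ω) = ω.1} with hAdef
  set ι := infoDensity code c KW v₀ σ L n with hι
  have hιm : Measurable ι := measurable_infoDensity code c KW v₀ hL le_rfl
  have hA : MeasurableSet A :=
    measurableSet_eq_fun ((code.measurable_dec v₀).comp (measurable_outputHistory code c v₀ le_rfl))
      measurable_fst
  have hMpos : (0 : ℝ) < code.M := by exact_mod_cast card_message_pos code
  set f : Fin code.M × (ℕ → ℝ) → ℝ := A.indicator fun _ => Real.log code.M with hf
  have hfint : Integrable f (code.law KW) := (integrable_const _).indicator hA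
  have hle : ∀ ω, ENNReal.ofReal (Real.exp (f ω - ι ω)) ≤
      (1 + (code.M : ℝ≥0∞) * A.indicator 1 ω) * ENNReal.ofReal (Real.exp (-ι ω)) := by
    intro ω
    rw [sub_eq_add_neg, Real.exp_add, ENNReal.ofReal_mul (Real.exp_pos _).le]
    gcongr
    by_cases hω : ω ∈ A
    · simp [hf, hω, Real.exp_log hMpos]
    · simp [hf, hω]
  have hlin : ∫⁻ ω, ENNReal.ofReal (Real.exp (f ω - ι ω)) ∂code.law KW ≤ 2 :=
    (lintegral_mono hle).trans
      (lintegral_decoding_exp_neg_infoDensity_le code c KW v₀ hKW hσ hL)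
  have hem : Measurable fun ω => Real.exp (f ω - ι ω) :=
    ((measurable_const.indicator hA).sub hιm).exp
  have heint : Integrable (fun ω => Real.exp (f ω - ι ω)) (code.law KW) := by
    refine ⟨hem.aestronglyMeasurable, ?_⟩
    rw [hasFiniteIntegral_iff_ofReal (Filter.Eventually.of_forall fun ω => (Real.exp_pos _).le)]
    exact hlin.trans_lt (by simp)
  have hexp : ∫ ω, Real.exp (f ω - ι ω) ∂code.law KW ≤ 2 := by
    rw [integral_eq_lintegral_of_nonneg_ae
      (Filter.Eventually.of_forall fun ω => (Real.exp_pos _).le) hem.aestronglyMeasurable]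
    exact ENNReal.toReal_le_of_le_ofReal (by norm_num) (by simpa using hlin)
  -- Tangent line of the logarithm at 2, the bound on the exponential moment; after integration only
  -- log 2 survives.
  have hpt : ∀ ω, f ω - ι ω ≤ Real.log 2 - 1 + Real.exp (f ω - ι ω) / 2 := by
    intro ω
    have := Real.log_le_sub_one_of_pos (show 0 < Real.exp (f ω - ι ω) / 2 by positivity)
    rw [Real.log_div (Real.exp_pos _).ne' two_ne_zero, Real.log_exp] at this
    linarith
  have hmono := integral_mono (hfint.sub hint)
    ((integrable_const (Real.log 2 - 1)).add (heint.div_const 2)) hpt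
  simp only [Pi.sub_apply, Pi.add_apply] at hmono
  rw [integral_sub hfint hint, integral_add (integrable_const _) (heint.div_const 2),
    integral_div] at hmono
  have hcompl : code.errorProb c KW v₀ = 1 - (code.law KW).real A := by
    rw [← probReal_compl_eq_one_sub hA]
    rfl
  have hfI : ∫ ω, f ω ∂code.law KW = (1 - code.errorProb c KW v₀) * Real.log code.M := by
    rw [hf, integral_indicator_const _ hA, hcompl, smul_eq_mul]
    ring
  rw [hfI] at hmono
  simp only [integral_const, probReal_univ, one_smul] at hmono
  linarith

/-! ### Second moments of the noise -/

theorem map_innovation_law (s : ℕ) :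
    (code.law KW).map (fun ω => ω.2 s) = gaussianReal 0 (KW s) := by
  have h : (fun ω : Fin code.M × (ℕ → ℝ) => ω.2 s) = (fun w : ℕ → ℝ => w s) ∘ Prod.snd := rfl
  rw [h, ← Measure.map_map (measurable_pi_apply s) measurable_snd, FeedbackCode.law,
    Measure.map_snd_prod, measure_univ, one_smul, innovLaw]
  exact Measure.infinitePi_map_eval _ s

theorem measurable_innovation (s : ℕ) :
    Measurable fun ω : Fin code.M × (ℕ → ℝ) => ω.2 s :=
  (measurable_pi_apply s).comp measurable_snd

theorem memLp_innovation (s : ℕ) : MemLp (fun ω => ω.2 s) 2 (code.law KW) := by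
  have h := memLp_id_gaussianReal' (μ := 0) (v := KW s) 2 (by simp)
  rw [← map_innovation_law code] at h
  exact (memLp_map_measure_iff aestronglyMeasurable_id
    (measurable_innovation code s).aemeasurable).1 h

theorem integral_innovation_sq (s : ℕ) : ∫ ω, ω.2 s ^ 2 ∂code.law KW = KW s := by
  have h := variance_fun_id_gaussianReal (μ := 0) (v := KW s)
  rw [variance_eq_integral (by fun_prop)] at h
  simp only [integral_id_gaussianReal, sub_zero] at h
  rw [← map_innovation_law code, integral_map (measurable_innovation code s).aemeasurable
    (by fun_prop)] at h
  exact h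

theorem map_update_law (s : ℕ) :
    ((code.law KW).prod (gaussianReal 0 (KW s))).map
      (fun p => (p.1.1, Function.update p.1.2 s p.2)) = code.law KW := by
  have hm : Measurable fun p : (Fin code.M × (ℕ → ℝ)) × ℝ =>
      (p.1.1, Function.update p.1.2 s p.2) :=
    (measurable_fst.comp measurable_fst).prodMk
      ((measurable_update_prod s).comp ((measurable_snd.comp measurable_fst).prodMk measurable_snd))
  have h : (fun p : (Fin code.M × (ℕ → ℝ)) × ℝ => (p.1.1, Function.update p.1.2 s p.2)) =
      Prod.map id (fun p : (ℕ → ℝ) × ℝ => Function.update p.1 s p.2) ∘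
        MeasurableEquiv.prodAssoc := rfl
  rw [h, ← Measure.map_map (measurable_id.prodMap (measurable_update_prod s))
    MeasurableEquiv.prodAssoc.measurable, FeedbackCode.law, Measure.prodAssoc_prod,
    ← Measure.map_prod_map _ _ measurable_id (measurable_update_prod s), Measure.map_id,
    map_update_innovLaw]

/-- Resampling the innovation makes it independent of `F`, and it has mean zero. -/
theorem integral_innovation_mul_eq_zero {s : ℕ} {F : Fin code.M × (ℕ → ℝ) → ℝ}
    (hF : Measurable F) (hFs : ∀ m w z, F (m, Function.update w s z) = F (m, w)) :
    ∫ ω, ω.2 s * F ω ∂code.law KW = 0 := by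
  have hm : Measurable fun p : (Fin code.M × (ℕ → ℝ)) × ℝ =>
      (p.1.1, Function.update p.1.2 s p.2) :=
    (measurable_fst.comp measurable_fst).prodMk
      ((measurable_update_prod s).comp ((measurable_snd.comp measurable_fst).prodMk measurable_snd))
  have hprod : Measurable fun ω : Fin code.M × (ℕ → ℝ) => ω.2 s * F ω :=
    (measurable_innovation code s).mul hF
  rw [← map_update_law code KW s, integral_map hm.aemeasurable hprod.aestronglyMeasurable]
  have h : ∀ p : (Fin code.M × (ℕ → ℝ)) × ℝ,
      Function.update p.1.2 s p.2 s * F (p.1.1, Function.update p.1.2 s p.2) = F p.1 * p.2 := by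
    intro p
    rw [hFs, Function.update_self, mul_comm]
  simp_rw [h]
  -- The factorization needs no integrability of `F`: the Gaussian factor has integral zero in any
  -- case.
  rw [integral_prod_mul F fun z : ℝ => z]
  simp

theorem memLp_arNoise (t : ℕ) : MemLp (fun ω => arNoise c v₀ ω.2 t) 2 (code.law KW) := by
  induction t with
  | zero => exact memLp_const _
  | succ t ih => exact (ih.const_mul _).add (memLp_innovation code KW (t + 1))

end Converse

section Converse

open MeasureTheory ProbabilityTheory

open scoped ENNReal InnerProductSpace

/-! ### Square integrable random variables -/

section L2

variable {Ω : Type*} [MeasurableSpace Ω] {μ : Measure Ω}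

open Classical in
/-- The class in `L²` of a square integrable function, and `0` for other functions. -/
noncomputable def l2Class (μ : Measure Ω) (f : Ω → ℝ) : Lp ℝ 2 μ :=
  if h : MemLp f 2 μ then h.toLp f else 0

theorem coeFn_l2Class {f : Ω → ℝ} (hf : MemLp f 2 μ) : l2Class μ f =ᵐ[μ] f := by
  rw [l2Class, dif_pos hf]
  exact hf.coeFn_toLp

theorem l2Class_add {f g : Ω → ℝ} (hf : MemLp f 2 μ) (hg : MemLp g 2 μ) :
    l2Class μ (fun ω => f ω + g ω) = l2Class μ f + l2Class μ g := by
  have h : MemLp (fun ω => f ω + g ω) 2 μ := hf.add hg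
  rw [l2Class, l2Class, l2Class, dif_pos hf, dif_pos hg, dif_pos h]
  exact MemLp.toLp_add hf hg

theorem l2Class_const_mul (a : ℝ) {f : Ω → ℝ} (hf : MemLp f 2 μ) :
    l2Class μ (fun ω => a * f ω) = a • l2Class μ f := by
  have h : MemLp (fun ω => a * f ω) 2 μ := hf.const_mul a
  rw [l2Class, l2Class, dif_pos hf, dif_pos h]
  exact MemLp.toLp_const_smul a hf

theorem inner_eq_integral_of_ae_eq {u v : Lp ℝ 2 μ} {f g : Ω → ℝ} (hu : u =ᵐ[μ] f)
    (hv : v =ᵐ[μ] g) : ⟪u, v⟫_ℝ = ∫ ω, f ω * g ω ∂μ := by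
  rw [L2.inner_def]
  refine integral_congr_ae ?_
  filter_upwards [hu, hv] with ω h1 h2
  simp [h1, h2, mul_comm]

theorem norm_sq_eq_integral_of_ae_eq {u : Lp ℝ 2 μ} {f : Ω → ℝ} (hu : u =ᵐ[μ] f) :
    ‖u‖ ^ 2 = ∫ ω, f ω ^ 2 ∂μ := by
  rw [← real_inner_self_eq_norm_sq, inner_eq_integral_of_ae_eq hu hu]
  simp only [sq]

end L2

/-! ### The linear model attached to a feedback code -/

variable {n : ℕ} {code : FeedbackCode n} {c : ℕ → ℝ} {KW : ℕ → ℝ≥0} {v₀ : ℝ}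

/-- The power constraint bounds an integral with values in [0, ∞], so it already contains the
finiteness that integrability requires. -/
theorem integrable_sum_channelInput_sq {κ : ℝ} (hp : code.PowerConstraint c KW κ v₀) :
    Integrable (fun ω => (1 / (n : ℝ)) * ∑ t ∈ Finset.range n, channelInput code c v₀ t ω ^ 2)
      (code.law KW) := by
  refine ⟨Measurable.aestronglyMeasurable ?_, ?_⟩
  · exact (Finset.measurable_sum _ fun t ht =>
      (measurable_channelInput code c v₀ (Finset.mem_range.1 ht)).pow_const 2).const_mul _
  · rw [hasFiniteIntegral_iff_ofReal (Filter.Eventually.of_forall fun ω => by positivity)]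
    simp only [FeedbackCode.PowerConstraint, sum_input_sq] at hp
    exact hp.trans_lt ENNReal.ofReal_lt_top

theorem integral_sum_channelInput_sq_le {κ : ℝ} (hκ : 0 ≤ κ)
    (hp : code.PowerConstraint c KW κ v₀) :
    ∫ ω, (1 / (n : ℝ)) * ∑ t ∈ Finset.range n, channelInput code c v₀ t ω ^ 2 ∂code.law KW ≤ κ := by
  rw [integral_eq_lintegral_of_nonneg_ae (Filter.Eventually.of_forall fun ω => by positivity)
    (integrable_sum_channelInput_sq hp).1]
  simp only [FeedbackCode.PowerConstraint, sum_input_sq] at hp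
  exact ENNReal.toReal_le_of_le_ofReal hκ hp

theorem memLp_channelInput {κ : ℝ} (hp : code.PowerConstraint c KW κ v₀) {t : ℕ} (ht : t < n) :
    MemLp (channelInput code c v₀ t) 2 (code.law KW) := by
  have hm := measurable_channelInput code c v₀ ht
  rw [memLp_two_iff_integrable_sq hm.aestronglyMeasurable]
  refine ((integrable_sum_channelInput_sq hp).const_mul n).mono
    (hm.pow_const 2).aestronglyMeasurable (Filter.Eventually.of_forall fun ω => ?_)
  have hn : (n : ℝ) ≠ 0 := by exact_mod_cast (show n ≠ 0 by omega)
  rw [← mul_assoc, mul_one_div_cancel hn, one_mul, Real.norm_of_nonneg (sq_nonneg _),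
    Real.norm_of_nonneg (Finset.sum_nonneg fun _ _ => sq_nonneg _)]
  exact Finset.single_le_sum (f := fun s => channelInput code c v₀ s ω ^ 2)
    (fun _ _ => sq_nonneg _) (Finset.mem_range.2 ht)

theorem memLp_channelOutput {κ : ℝ} (hp : code.PowerConstraint c KW κ v₀) {t : ℕ} (ht : t < n) :
    MemLp (channelOutput code c v₀ t) 2 (code.law KW) :=
  (memLp_channelInput hp ht).add (memLp_arNoise code c KW v₀ (t + 1))

/-- Elements of the observation space are functions of the observed outputs. -/
theorem exists_measurable_of_mem_observationSpace {κ : ℝ} (hp : code.PowerConstraint c KW κ v₀)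
    {t : ℕ} (ht : t ≤ n) {u : Lp ℝ 2 (code.law KW)}
    (hu : u ∈ observationSpace (l2Class (code.law KW) fun _ => 1)
      (fun s => l2Class (code.law KW) (channelOutput code c v₀ s)) t) :
    ∃ L : (Fin t → ℝ) → ℝ, Measurable L ∧
      u =ᵐ[code.law KW] fun ω => L (outputHistory code c v₀ t ω) := by
  induction t generalizing u with
  | zero =>
    obtain ⟨a, rfl⟩ := Submodule.mem_span_singleton.1 hu
    refine ⟨fun _ => a, measurable_const, ?_⟩
    filter_upwards [Lp.coeFn_smul a (l2Class (code.law KW) fun _ => (1 : ℝ)),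
      coeFn_l2Class (μ := code.law KW) (memLp_const (1 : ℝ))] with ω h1 h2
    simp [h1, h2]
  | succ t ih =>
    obtain ⟨u', hu', z, hz, rfl⟩ := Submodule.mem_sup.1 hu
    obtain ⟨a, rfl⟩ := Submodule.mem_span_singleton.1 hz
    obtain ⟨L, hL, huL⟩ := ih (by omega) hu'
    refine ⟨fun y => L (fun i => y i.castSucc) + a * y (Fin.last t), ?_, ?_⟩
    · exact (hL.comp (measurable_pi_lambda _ fun i => measurable_pi_apply _)).add
        (show Measurable fun y : Fin (t + 1) → ℝ => a * y (Fin.last t) by fun_prop)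
    · filter_upwards [huL, Lp.coeFn_add u' (a • l2Class (code.law KW) (channelOutput code c v₀ t)),
        Lp.coeFn_smul a (l2Class (code.law KW) (channelOutput code c v₀ t)),
        coeFn_l2Class (memLp_channelOutput hp (show t < n by omega))] with ω h1 h2 h3 h4
      refine h2.trans ?_
      rw [Pi.add_apply, h1, h3, Pi.smul_apply, h4, smul_eq_mul, outputHistory_succ]
      simp only [Fin.snoc_castSucc, Fin.snoc_last]

/-- The outputs of a code with power at most `κ` have predictors from the past outputs whose squared
errors `σ_t` satisfy `∑ (1/2) log (σ_t / K_{W_t}) ≤ C_n`. -/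
theorem exists_predictor (hKW : ∀ t, 1 ≤ t → 0 < KW t) {κ : ℝ} (hκ : 0 ≤ κ)
    (hC : ∃ Λ KZ : ℕ → ℝ, IsMaximizer c KW κ n Λ KZ) (hp : code.PowerConstraint c KW κ v₀) :
    ∃ (L : (t : ℕ) → (Fin t → ℝ) → ℝ) (σ : ℕ → ℝ≥0), (∀ t, Measurable (L t)) ∧
      (∀ t < n, 0 < σ t) ∧
      (∀ t < n, MemLp (fun ω => channelOutput code c v₀ t ω - L t (outputHistory code c v₀ t ω)) 2
        (code.law KW)) ∧
      (∀ t < n, ∫ ω, (channelOutput code c v₀ t ω - L t (outputHistory code c v₀ t ω)) ^ 2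
        ∂code.law KW = σ t) ∧
      ∑ t ∈ Finset.range n, (1 / 2) * Real.log (σ t / KW (t + 1)) ≤ ftfiCapacity c KW κ n := by
  set μ := code.law KW with hμ
  set one : Lp ℝ 2 μ := l2Class μ fun _ => 1 with hone
  set x : ℕ → Lp ℝ 2 μ := fun t => l2Class μ (channelInput code c v₀ t) with hx
  set y : ℕ → Lp ℝ 2 μ := fun t => l2Class μ (channelOutput code c v₀ t) with hy
  set v : ℕ → Lp ℝ 2 μ := fun t => l2Class μ (fun ω => arNoise c v₀ ω.2 t) with hv
  set w : ℕ → Lp ℝ 2 μ := fun t => l2Class μ (fun ω => ω.2 (t + 1)) with hw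
  have hxm : ∀ t < n, MemLp (channelInput code c v₀ t) 2 μ := fun t ht => memLp_channelInput hp ht
  have hym : ∀ t < n, MemLp (channelOutput code c v₀ t) 2 μ := fun t ht =>
    memLp_channelOutput hp ht
  have hvm : ∀ t, MemLp (fun ω => arNoise c v₀ ω.2 t) 2 μ := memLp_arNoise code c KW v₀
  have hwm : ∀ s, MemLp (fun ω => ω.2 s) 2 μ := memLp_innovation code KW
  have horth : ∀ (t : ℕ) {u : Lp ℝ 2 μ} {F : Fin code.M × (ℕ → ℝ) → ℝ}, u =ᵐ[μ] F → Measurable F →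
      (∀ m w z, F (m, Function.update w (t + 1) z) = F (m, w)) → ⟪w t, u⟫_ℝ = 0 :=
    fun t u F huF hF hFs => by
      rw [inner_eq_integral_of_ae_eq (coeFn_l2Class (hwm (t + 1))) huF]
      exact integral_innovation_mul_eq_zero code KW hF hFs
  have hpow : (1 / (n : ℝ)) * ∑ t ∈ Finset.range n, ‖x t‖ ^ 2 ≤ κ := by
    refine le_trans (le_of_eq ?_) (integral_sum_channelInput_sq_le hκ hp)
    rw [integral_const_mul, integral_finsetSum _ fun t ht =>
      (hxm t (Finset.mem_range.1 ht)).integrable_sq]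
    congr 1
    exact Finset.sum_congr rfl fun t ht =>
      norm_sq_eq_integral_of_ae_eq (coeFn_l2Class (hxm t (Finset.mem_range.1 ht)))
  obtain ⟨hge, hsum⟩ := sum_log_innovation_le_ftfiCapacity (one := one) (x := x) (y := y) (v := v)
    (w := w) (v₀ := v₀) hKW hC
    (by
      have := l2Class_const_mul v₀ (memLp_const (μ := μ) (p := 2) (1 : ℝ))
      simp only [mul_one] at this
      exact this)
    (fun t _ => by
      have h := l2Class_add ((hvm t).const_mul (c (t + 1))) (hwm (t + 1))
      rw [l2Class_const_mul _ (hvm t)] at h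
      exact h)
    (fun t ht => l2Class_add (hxm t ht) (hvm (t + 1)))
    (fun t _ => (norm_sq_eq_integral_of_ae_eq (coeFn_l2Class (hwm (t + 1)))).trans
      (integral_innovation_sq code KW (t + 1)))
    (fun t ht => horth t (coeFn_l2Class (hxm t ht)) (measurable_channelInput code c v₀ ht)
      fun m w z => channelInput_update code c v₀ (Nat.lt_succ_self t) m w z)
    (fun t _ => horth t (coeFn_l2Class (hvm t)) ((measurable_arNoise c v₀ t).comp measurable_snd)
      fun m w z => arNoise_update c v₀ (Nat.lt_succ_self t) w z)
    (fun t ht u hu => by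
      obtain ⟨L, hL, huL⟩ := exists_measurable_of_mem_observationSpace hp ht.le hu
      exact horth t huL (hL.comp (measurable_outputHistory code c v₀ ht.le)) fun m w z =>
        congrArg L (outputHistory_update code c v₀ (Nat.lt_succ_self t) m w z))
    hpow
  have hpred : ∀ t, ∃ L : (Fin t → ℝ) → ℝ, Measurable L ∧ (t < n →
      (observationSpace one y t).starProjection (y t) =ᵐ[μ]
        fun ω => L (outputHistory code c v₀ t ω)) := by
    intro t
    by_cases ht : t < n
    · obtain ⟨L, hL, huL⟩ := exists_measurable_of_mem_observationSpace hp ht.le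
        (Submodule.starProjection_apply_mem (observationSpace one y t) (y t))
      exact ⟨L, hL, fun _ => huL⟩
    · exact ⟨fun _ => 0, measurable_const, fun h => absurd h ht⟩
  choose L hL hLae using hpred
  have hae : ∀ t < n, (y t - (observationSpace one y t).starProjection (y t) : Lp ℝ 2 μ) =ᵐ[μ]
      fun ω => channelOutput code c v₀ t ω - L t (outputHistory code c v₀ t ω) := by
    intro t ht
    filter_upwards [Lp.coeFn_sub (y t) ((observationSpace one y t).starProjection (y t)),
      hLae t ht, coeFn_l2Class (hym t ht)] with ω h1 h2 h3
    rw [h1, Pi.sub_apply, h2, h3]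
  -- The reference variance is the squared prediction error itself. It is positive since the fresh
  -- innovation alone contributes `KW (t + 1)`.
  refine ⟨L, fun t => ‖y t - (observationSpace one y t).starProjection (y t)‖₊ ^ 2, hL,
    fun t ht => ?_, fun t ht => ?_, fun t ht => ?_, ?_⟩
  · rw [← NNReal.coe_pos]
    have : (0 : ℝ) < KW (t + 1) := hKW (t + 1) (by omega)
    push_cast
    exact this.trans_le (hge t ht)
  · exact (memLp_congr_ae (hae t ht)).1 (Lp.memLp _)
  · rw [← norm_sq_eq_integral_of_ae_eq (hae t ht)]
    push_cast
    rfl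
  · push_cast
    exact hsum

theorem integrable_infoDensity {σ : ℕ → ℝ≥0} {L : (t : ℕ) → (Fin t → ℝ) → ℝ}
    (hL : ∀ t < n, MemLp
      (fun ω => channelOutput code c v₀ t ω - L t (outputHistory code c v₀ t ω)) 2 (code.law KW)) :
    Integrable (infoDensity code c KW v₀ σ L n) (code.law KW) := by
  refine integrable_finsetSum _ fun t ht => ?_
  exact ((integrable_const _).sub ((memLp_innovation code KW (t + 1)).integrable_sq.div_const _)).add
    ((hL t (Finset.mem_range.1 ht)).integrable_sq.div_const _)

/-- Each of the two quadratic terms has mean 1/2, because `σ t` is the true mean squared error; they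
cancel and the logarithms remain. -/
theorem integral_infoDensity (hKW : ∀ t, 1 ≤ t → 0 < KW t) {σ : ℕ → ℝ≥0}
    {L : (t : ℕ) → (Fin t → ℝ) → ℝ} (hσ : ∀ t < n, 0 < σ t)
    (hL : ∀ t < n, MemLp
      (fun ω => channelOutput code c v₀ t ω - L t (outputHistory code c v₀ t ω)) 2 (code.law KW))
    (hLσ : ∀ t < n, ∫ ω, (channelOutput code c v₀ t ω - L t (outputHistory code c v₀ t ω)) ^ 2
        ∂code.law KW = σ t) :
    ∫ ω, infoDensity code c KW v₀ σ L n ω ∂code.law KW =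
      ∑ t ∈ Finset.range n, (1 / 2) * Real.log (σ t / KW (t + 1)) := by
  have h1 : ∀ t, Integrable (fun ω : Fin code.M × (ℕ → ℝ) => (1 / 2) * Real.log (σ t / KW (t + 1)) -
      ω.2 (t + 1) ^ 2 / (2 * KW (t + 1))) (code.law KW) := fun t =>
    (integrable_const _).sub ((memLp_innovation code KW (t + 1)).integrable_sq.div_const _)
  have h2 : ∀ t ∈ Finset.range n, Integrable (fun ω => (channelOutput code c v₀ t ω -
      L t (outputHistory code c v₀ t ω)) ^ 2 / (2 * σ t)) (code.law KW) := fun t ht =>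
    (hL t (Finset.mem_range.1 ht)).integrable_sq.div_const _
  refine (integral_finsetSum _ fun t ht => (h1 t).add (h2 t ht)).trans ?_
  simp only [Pi.add_apply]
  refine Finset.sum_congr rfl fun t ht => ?_
  have hσt : (0 : ℝ) < σ t := hσ t (Finset.mem_range.1 ht)
  have hKt : (0 : ℝ) < KW (t + 1) := hKW (t + 1) (by omega)
  rw [integral_add (h1 t) (h2 t ht), integral_sub (integrable_const _)
    ((memLp_innovation code KW (t + 1)).integrable_sq.div_const _), integral_div, integral_div,
    integral_innovation_sq, hLσ t (Finset.mem_range.1 ht), integral_const, probReal_univ, one_smul]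
  field_simp
  ring

/-- The converse bound at block length `n`. -/
theorem one_sub_errorProb_mul_log_le_ftfiCapacity (hKW : ∀ t, 1 ≤ t → 0 < KW t) {κ : ℝ}
    (hκ : 0 ≤ κ) (hC : ∃ Λ KZ : ℕ → ℝ, IsMaximizer c KW κ n Λ KZ)
    (hp : code.PowerConstraint c KW κ v₀) :
    (1 - code.errorProb c KW v₀) * Real.log code.M ≤ Real.log 2 + ftfiCapacity c KW κ n := by
  obtain ⟨L, σ, hL, hσ, hL2, hLσ, hsum⟩ := exists_predictor hKW hκ hC hp
  have h := one_sub_errorProb_mul_log_le code c KW v₀ hKW hσ hL (integrable_infoDensity hL2)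
  rw [integral_infoDensity hKW hσ hL2 hLσ] at h
  linarith

end Converse

end AGN

/-! ### Passage to the limit in the block length -/

theorem mainTheorem12
    (c : ℕ → ℝ) (KW : ℕ → ℝ≥0) (hKW : ∀ t, 1 ≤ t → 0 < KW t)
    (κ : ℝ) (hκ : 0 ≤ κ) (v₀ : ℝ)
    (hC1 : ∀ n, 1 ≤ n → ∃ Λ KZ : ℕ → ℝ, AGN.IsMaximizer c KW κ n Λ KZ)
    (C : ℝ)
    (hC2 : Filter.Tendsto (fun n : ℕ => (1 / (n : ℝ)) * AGN.ftfiCapacity c KW κ n)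
      Filter.atTop (nhds C))
    (R : ℝ) (hR : AGN.IsAchievableRate c KW κ v₀ R) :
    R ≤ C := by
  obtain ⟨code, ε, hcode, hε, hlim⟩ := hR
  refine le_of_forall_lt fun r hr => ?_
  -- The slack between `r'` and `R` turns the bound on the limit inferior into an eventual bound on
  -- the rates; the slack between `r` and `r'` leaves only `r' ≤ C` to prove.
  obtain ⟨r', hr, hr'⟩ := exists_between hr
  refine hr.trans_le ?_
  have hrate : ∀ᶠ n in Filter.atTop, ((r' : ℝ) : EReal) < ((code n).rate : ℝ) :=
    Filter.eventually_lt_of_lt_liminf ((EReal.coe_lt_coe_iff.2 hr').trans_le hlim)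
  -- Ensures that multiplying the rate bound by 1 - ε preserves its direction.
  have hone : ∀ᶠ n in Filter.atTop, ε n < 1 := hε.eventually_lt_const one_pos
  have hl : Filter.Tendsto (fun n : ℕ => (1 - ε n) * r') Filter.atTop (nhds ((1 - 0) * r')) :=
    (hε.const_sub 1).mul_const r'
  have hu : Filter.Tendsto (fun n : ℕ => (1 / (n : ℝ)) * Real.log 2 +
      (1 / (n : ℝ)) * AGN.ftfiCapacity c KW κ n) Filter.atTop (nhds (0 * Real.log 2 + C)) :=
    (tendsto_one_div_atTop_nhds_zero_nat.mul_const _).add hC2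
  rw [sub_zero, one_mul] at hl
  rw [zero_mul, zero_add] at hu
  refine le_of_tendsto_of_tendsto hl hu ?_
  filter_upwards [hrate, hone, Filter.eventually_ge_atTop 1] with n h1 h2 hn
  obtain ⟨hp, herr⟩ := hcode n hn
  have hfano := AGN.one_sub_errorProb_mul_log_le_ftfiCapacity hKW hκ (hC1 n hn) hp
  have hlog : 0 ≤ Real.log (code n).M := Real.log_natCast_nonneg _
  have h1 : r' < (1 / (n : ℝ)) * Real.log (code n).M := EReal.coe_lt_coe_iff.1 h1
  calc (1 - ε n) * r' ≤ (1 - ε n) * ((1 / (n : ℝ)) * Real.log (code n).M) := by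
        gcongr
    _ ≤ (1 - (code n).errorProb c KW v₀) * ((1 / (n : ℝ)) * Real.log (code n).M) := by
        gcongr
    _ = (1 / (n : ℝ)) * ((1 - (code n).errorProb c KW v₀) * Real.log (code n).M) := by ring
    _ ≤ (1 / (n : ℝ)) * (Real.log 2 + AGN.ftfiCapacity c KW κ n) := by gcongr
    _ = _ := by ring
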